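/- Let $G$ be a finite simple graph with vertex set $V$, let $\mathbf{k}$ be a field, and let $I = I(G) = (x_u x_v \mid \{u,v\} \in E(G))$ be the edge ideal of $G$ in $S = \mathbf{k}[x_v \mid v \in V]$. For an integer $s \ge 0$, let $\overline{I^s}$ be the integral closure of the ideal $I^s$, that is, the ideal of all $r \in S$ satisfying an equation $r^n + a_1 r^{n-1} + \cdots + a_n = 0$ with $n \ge 1$ and $a_i \in (I^s)^i$ for all $i$. Let $f$ be a minimal generator of the monomial ideal $\overline{I^s}$, i.e. a monomial in $\overline{I^s}$ none of whose proper monomial divisors lies in $\overline{I^s}$. Then there exist integers $a, b \ge 0$, odd cycles $C_1, \ldots, C_{2a}$ of $G$ and edges $e_1, \ldots, e_b$ of $G$ (repetitions allowed) such that $$f = x_{C_1} \cdots x_{C_{2a}} \cdot x_{e_1} \cdots x_{e_b} \qquad\text{and}\qquad \frac{|C_1| + \cdots + |C_{2a}|}{2} + b = s,$$ and moreover $N(C_i) \cap C_j = \emptyset$ for all $i \ne j$ in $\{1, \ldots, 2a\}$. Here a cycle is a closed walk through $m \ge 3$ distinct vertices (not necessarily induced), and is identified with its vertex set; $|C|$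 is its number of vertices, $x_C = \prod_{v \in C} x_v$, $x_e = x_u x_v$ for an edge $e = \{u,v\}$, and $N(C)$ is the set of all vertices adjacent to at least one vertex of $C$. -/

import Mathlib

open scoped Polynomial

namespace EdgeIdeal

section IntegralClosure

/-- `r` is integral over the ideal `I`: it satisfies an equation
`r ^ n + a₁ r ^ (n - 1) + ⋯ + aₙ = 0` with `n ≥ 1` and `aᵢ ∈ I ^ i`. -/
def IsIntegralOver {R : Type*} [CommRing R] (I : Ideal R) (r : R) : Prop :=
  ∃ (n : ℕ) (a : ℕ → R), 0 < n ∧ (∀ i ∈ Finset.Icc 1 n, a i ∈ I ^ i) ∧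
    r ^ n + ∑ i ∈ Finset.Icc 1 n, a i * r ^ (n - i) = 0

/-- `r` is integral over `I` iff `r t` is integral over the Rees algebra of `I`. -/
theorem isIntegralOver_iff {R : Type*} [CommRing R] (I : Ideal R) (r : R) :
    IsIntegralOver I r ↔ IsIntegral (reesAlgebra I) (Polynomial.monomial 1 r : R[X]) := by
  constructor
  · rintro ⟨n, a, hn, ha, h⟩
    let c : ℕ → reesAlgebra I := fun i =>
      if hi : i ∈ Finset.Icc 1 n then
        ⟨Polynomial.monomial i (a i), reesAlgebra.monomial_mem.mpr (ha i hi)⟩ else 0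
    refine ⟨Polynomial.X ^ n + ∑ i ∈ Finset.Icc 1 n,
      Polynomial.C (c i) * Polynomial.X ^ (n - i), ?_, ?_⟩
    · apply Polynomial.monic_X_pow_add
      rw [← Polynomial.mem_degreeLT]
      refine Submodule.sum_mem _ fun i hi => ?_
      rw [Polynomial.mem_degreeLT]
      refine (Polynomial.degree_C_mul_X_pow_le _ _).trans_lt ?_
      rw [Finset.mem_Icc] at hi
      exact_mod_cast (by omega : n - i < n)
    · rw [Polynomial.eval₂_add, Polynomial.eval₂_finsetSum, Polynomial.eval₂_X_pow]
      have : ∀ i ∈ Finset.Icc 1 n,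
          Polynomial.eval₂ (algebraMap (reesAlgebra I) R[X]) (Polynomial.monomial 1 r)
            (Polynomial.C (c i) * Polynomial.X ^ (n - i))
          = Polynomial.monomial n (a i * r ^ (n - i)) := by
        intro i hi
        rw [Polynomial.eval₂_mul, Polynomial.eval₂_C, Polynomial.eval₂_X_pow,
          Polynomial.monomial_pow]
        have hc : algebraMap (reesAlgebra I) R[X] (c i) = Polynomial.monomial i (a i) := by
          simp only [c, dif_pos hi]; rfl
        rw [hc, Polynomial.monomial_mul_monomial]
        rw [Finset.mem_Icc] at hi
        rw [one_mul, Nat.add_sub_cancel' hi.2]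
      rw [Finset.sum_congr rfl this, Polynomial.monomial_pow, ← map_sum, one_mul, ← map_add, h,
        map_zero]
  · rintro ⟨p, hp, h⟩
    rcases subsingleton_or_nontrivial R with hR | hR
    · exact ⟨1, 0, one_pos, by simp, Subsingleton.elim _ _⟩
    have hn : 0 < p.natDegree := by
      rcases Nat.eq_zero_or_pos p.natDegree with h0 | h0
      · rw [Polynomial.eq_one_of_monic_natDegree_zero hp h0, Polynomial.eval₂_one] at h
        exact absurd h one_ne_zero
      · exact h0
    set n := p.natDegree with hnd
    refine ⟨n, fun i => ((p.coeff (n - i) : reesAlgebra I) : R[X]).coeff i, hn,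
      fun i _ => (mem_reesAlgebra_iff I _).mp (p.coeff (n - i)).2 i, ?_⟩
    have h2 := congrArg (fun q : R[X] => q.coeff n) h
    simp only [Polynomial.eval₂_eq_sum_range, Polynomial.finsetSum_coeff,
      Polynomial.coeff_zero] at h2
    rw [← hnd, Finset.sum_range_succ] at h2
    have key : ∀ k ≤ n, ((algebraMap (reesAlgebra I) R[X]) (p.coeff k) *
        (Polynomial.monomial 1 r) ^ k).coeff n
        = ((p.coeff k : reesAlgebra I) : R[X]).coeff (n - k) * r ^ k := by
      intro k hk
      rw [Polynomial.monomial_pow, one_mul]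
      conv_lhs => rw [← Nat.sub_add_cancel hk]
      rw [Polynomial.coeff_mul_monomial]
      rfl
    rw [key n le_rfl, Finset.sum_congr rfl (fun k hk => key k (Finset.mem_range.mp hk).le)] at h2
    have h1 : (p.coeff n) = 1 := hp.coeff_natDegree
    rw [h1, Nat.sub_self, OneMemClass.coe_one, Polynomial.coeff_one_zero, one_mul, add_comm] at h2
    rw [← h2]
    congr 1
    refine Finset.sum_bij' (fun i _ => n - i) (fun k _ => n - k) ?_ ?_ ?_ ?_ ?_
    · intro i hi
      rw [Finset.mem_Icc] at hi
      rw [Finset.mem_range]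
      omega
    · intro i hi
      rw [Finset.mem_range] at hi
      rw [Finset.mem_Icc]
      omega
    · intro i hi
      rw [Finset.mem_Icc] at hi
      omega
    · intro i hi
      rw [Finset.mem_range] at hi
      omega
    · intro i hi
      rw [Finset.mem_Icc] at hi
      dsimp only
      rw [Nat.sub_sub_self hi.2]

/-- The integral closure of an ideal `I` of `R`: the ideal of all elements of `R` that are
integral over `I`. -/
def idealIntegralClosure {R : Type*} [CommRing R] (I : Ideal R) : Ideal R where
  carrier := {r | IsIntegralOver I r}
  zero_mem' := by
    rw [Set.mem_ofPred_eq, isIntegralOver_iff, map_zero]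
    exact isIntegral_zero
  add_mem' := by
    intro x y hx hy
    rw [Set.mem_ofPred_eq, isIntegralOver_iff] at hx hy ⊢
    rw [map_add]
    exact hx.add hy
  smul_mem' := by
    intro c x hx
    rw [Set.mem_ofPred_eq, isIntegralOver_iff] at hx ⊢
    rw [← Polynomial.smul_monomial]
    exact hx.smul c

theorem mem_idealIntegralClosure {R : Type*} [CommRing R] (I : Ideal R) (r : R) :
    r ∈ idealIntegralClosure I ↔ IsIntegralOver I r := Iff.rfl

end IntegralClosure

section Monomials

/-- `f` is a minimal generator of the monomial ideal `J`: a monomial of `J` such that no proper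
divisor of `f` that is a monomial lies in `J`. -/
def IsMinimalGenerator {V 𝕜 : Type*} [Field 𝕜] (J : Ideal (MvPolynomial V 𝕜))
    (f : MvPolynomial V 𝕜) : Prop :=
  ∃ α : V →₀ ℕ, f = MvPolynomial.monomial α 1 ∧ f ∈ J ∧
    ∀ β : V →₀ ℕ, β ≤ α → MvPolynomial.monomial β 1 ∈ J → β = α

end Monomials

section Graph

/-- The edge ideal `I(G)`, generated by the `x_u x_v` with `{u, v}` an edge of `G`. -/
noncomputable def edgeIdeal {V : Type*} (𝕜 : Type*) [Field 𝕜] (G : SimpleGraph V) :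
    Ideal (MvPolynomial V 𝕜) :=
  Ideal.span {f | ∃ u v : V, G.Adj u v ∧ f = MvPolynomial.X u * MvPolynomial.X v}

/-- The monomial `x_u x_v` of the unordered pair `{u, v}`. -/
noncomputable def edgeMonomial {V : Type*} (𝕜 : Type*) [Field 𝕜] (e : Sym2 V) :
    MvPolynomial V 𝕜 :=
  Sym2.lift ⟨fun u v => MvPolynomial.X u * MvPolynomial.X v, fun _ _ => mul_comm _ _⟩ e

/-- The open neighbourhood `N(U)`: the union of the neighbour sets of the vertices in `U`. -/
def neighborhood {V : Type*} (G : SimpleGraph V) (U : Set V) : Set V :=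
  ⋃ u ∈ U, G.neighborSet u

/-- An odd cycle of `G`: a closed walk through distinct vertices, of odd length (at least `3`). -/
structure OddCycle {V : Type*} (G : SimpleGraph V) where
  base : V
  walk : G.Walk base base
  isCycle : walk.IsCycle
  odd_length : Odd walk.length

/-- The set of vertices of an odd cycle. -/
def OddCycle.verts {V : Type*} [DecidableEq V] {G : SimpleGraph V} (C : OddCycle G) : Finset V :=
  C.walk.support.toFinset

/-- The monomial of an odd cycle: the product of the variables of its vertices. -/
noncomputable def OddCycle.monomial {V : Type*} [DecidableEq V] (𝕜 : Type*) [Field 𝕜]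
    {G : SimpleGraph V} (C : OddCycle G) : MvPolynomial V 𝕜 :=
  ∏ v ∈ C.verts, MvPolynomial.X v

end Graph

end EdgeIdeal

/-!
By comparing coefficients in an equation of integral dependence, a monomial `x ^ α` in the integral
closure of `I(G) ^ s` satisfies `x ^ (k α) ∈ I(G) ^ (s k)` for some `k ≥ 1`. So `k α` dominates a
sum of `s k` edges: with weights `1 / k`, these edges form a fractional matching of size `s` in
which every vertex `v` has capacity `α v` (`exists_matrix_of_coeff_ne_zero`).

The core of the proof is that such a matching can be made half-integral (`exists_mem_of_matrix`).
Replace every vertex `v` by `α v` copies and spread the weights evenly over the copies. The result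
is a symmetric matrix with row sums at most `1`, which becomes doubly stochastic when the diagonal
is filled up. Its off-diagonal entries sum to `2 s`, so by Birkhoff's theorem there is a permutation
that moves copies only along edges and moves at least `2 s` copies. Its cycles project to closed
walks in `G`. Every closed walk splits, by loop erasure, into edges traversed twice and cycles
(`closed_walk_mem`), and even cycles split into edges. This yields odd cycles `C₁, …, Cₙ` and edges
`e₁, …, e_b` whose exponent vectors have a sum `β ≤ α`, with `∑ |Cᵢ| / 2 + b ≥ s`.

Conversely, the monomial of such a collection is integral over `I(G) ^ s`, because its square lies
in `I(G) ^ (2 s)` (`monomial_mem_closure_of_mem`). Minimality of `x ^ α` therefore gives `β = α`, and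
also `∑ |Cᵢ| / 2 + b = s`: otherwise one could drop an edge, or replace an odd cycle by a perfect
matching of the cycle without one vertex (`size_eq_of_minimal`). As the `|Cᵢ|` are odd, their number
`n` is even. Finally, two odd cycles joined by an edge `uv` have the same monomial and the same size
as `uv` together with perfect matchings of the cycles without `u` and without `v`, so they can be
traded for edges (`exists_pairwise_cycles`).
-/

namespace EdgeIdeal

/-! ### Vertex counts of walks, edges and odd cycles -/

section Walks

variable {V : Type*} {G : SimpleGraph V}

/-- The exponent vector counting the visits of a walk to each vertex, its starting point not
counted. For a closed walk, every visit is thus counted once. -/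
noncomputable def walkVec {u v : V} (p : G.Walk u v) : V →₀ ℕ :=
  (p.support.tail.map fun x => Finsupp.single x 1).sum

@[simp]
theorem walkVec_nil (u : V) : walkVec (.nil : G.Walk u u) = 0 := by simp [walkVec]

@[simp]
theorem walkVec_cons {u v w : V} (h : G.Adj u v) (p : G.Walk v w) :
    walkVec (.cons h p) = Finsupp.single v 1 + walkVec p := by
  rw [walkVec, walkVec, SimpleGraph.Walk.support_cons, List.tail_cons]
  conv_lhs => rw [← p.cons_tail_support, List.map_cons, List.sum_cons]

theorem walkVec_append {u v w : V} (p : G.Walk u v) (q : G.Walk v w) :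
    walkVec (p.append q) = walkVec p + walkVec q := by
  simp [walkVec, SimpleGraph.Walk.tail_support_append]

theorem walkVec_rotate [DecidableEq V] {v : V} (c : G.Walk v v) (u : V) (h : u ∈ c.support) :
    walkVec (c.rotate u h) = walkVec c :=
  ((c.support_rotate u h).perm.map _).sum_eq

/-- The exponent vector of the monomial `x_u x_v` of an edge `{u, v}`. -/
noncomputable def edgeVec (e : Sym2 V) : V →₀ ℕ :=
  Sym2.lift ⟨fun u v => Finsupp.single u 1 + Finsupp.single v 1, fun _ _ => add_comm _ _⟩ e

@[simp]
theorem edgeVec_mk (u v : V) :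
    edgeVec s(u, v) = Finsupp.single u 1 + Finsupp.single v 1 := rfl

theorem edgeVec_ne_zero (e : Sym2 V) : edgeVec e ≠ 0 := by
  induction e with
  | _ u v =>
    intro h
    have := DFunLike.congr_fun h u
    simp at this

/-- Taking every second edge of a walk of even length covers each visit to a vertex once, except
that the last vertex is left out. -/
theorem exists_edges_of_even_walk {u v : V} (p : G.Walk u v) (hp : Even p.length) :
    ∃ E : List (Sym2 V), (∀ e ∈ E, e ∈ G.edgeSet) ∧ p.length = 2 * E.length ∧
      Finsupp.single u 1 + walkVec p = (E.map edgeVec).sum + Finsupp.single v 1 := by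
  match p with
  | .nil => exact ⟨[], by simp, by simp, by simp⟩
  | .cons h .nil => simp at hp
  | .cons (v := a) h (.cons (v := b) h' q) =>
    obtain ⟨E, hE, hl, hs⟩ := exists_edges_of_even_walk q
      (by simpa [Nat.even_add_one] using hp)
    refine ⟨s(u, a) :: E, ?_, ?_, ?_⟩
    · simpa using ⟨h, hE⟩
    · simp [hl]; ring
    · simp only [walkVec_cons, hs, List.map_cons, List.sum_cons, edgeVec_mk]
      abel
  termination_by p.length

/-- The first `n` steps of an orbit of a permutation that moves points along edges form a walk. -/
theorem exists_walk_of_perm {X : Type*} (π : X → V) (σ : Equiv.Perm X)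
    (hσ : ∀ x, σ x ≠ x → G.Adj (π x) (π (σ x))) (n : ℕ) (x y : X) (hx : σ x ≠ x)
    (hy : (σ ^ n) x = y) :
    ∃ p : G.Walk (π x) (π y), p.length = n ∧
      walkVec p = ∑ i ∈ Finset.range n, Finsupp.single (π ((σ ^ i) (σ x))) 1 := by
  induction n generalizing x with
  | zero =>
    obtain rfl : x = y := by simpa using hy
    exact ⟨.nil, by simp, by simp⟩
  | succ n ih =>
    obtain ⟨p, hp, hs⟩ := ih (σ x) (by simpa using hx) hy
    refine ⟨.cons (hσ x hx) p, by simp [hp], ?_⟩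
    rw [walkVec_cons, hs, Finset.sum_range_succ']
    simp only [pow_succ, Equiv.Perm.mul_apply, pow_zero, Equiv.Perm.one_apply]
    rw [add_comm]

variable [DecidableEq V]

/-- The exponent vector of the monomial of an odd cycle. -/
noncomputable def OddCycle.vec (C : OddCycle G) : V →₀ ℕ :=
  ∑ v ∈ C.verts, Finsupp.single v 1

theorem OddCycle.verts_eq (C : OddCycle G) : C.verts = C.walk.support.tail.toFinset := by
  have h := C.walk.cons_tail_support
  have hb : C.base ∈ C.walk.support.tail :=
    SimpleGraph.Walk.end_mem_tail_support C.isCycle.not_nil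
  rw [OddCycle.verts, ← h, List.toFinset_cons, List.tail_cons]
  exact Finset.insert_eq_of_mem (by simpa using hb)

theorem OddCycle.vec_eq_walkVec (C : OddCycle G) : C.vec = walkVec C.walk := by
  rw [OddCycle.vec, C.verts_eq, List.sum_toFinset _ C.isCycle.support_nodup, walkVec]

theorem OddCycle.card_verts (C : OddCycle G) : C.verts.card = C.walk.length := by
  rw [C.verts_eq, List.toFinset_card_of_nodup C.isCycle.support_nodup, List.length_tail,
    SimpleGraph.Walk.length_support, Nat.add_sub_cancel]

theorem OddCycle.odd_card_verts (C : OddCycle G) : Odd C.verts.card :=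
  C.card_verts ▸ C.odd_length

/-- An odd cycle with one vertex removed has a perfect matching. -/
theorem OddCycle.exists_edges (C : OddCycle G) {u : V} (hu : u ∈ C.verts) :
    ∃ E : List (Sym2 V), (∀ e ∈ E, e ∈ G.edgeSet) ∧ C.verts.card = 2 * E.length + 1 ∧
      C.vec = (E.map edgeVec).sum + Finsupp.single u 1 := by
  have hu' : u ∈ C.walk.support := by simpa [OddCycle.verts] using hu
  rw [C.card_verts, C.vec_eq_walkVec, ← walkVec_rotate C.walk u hu',
    ← C.walk.length_rotate u hu']
  have ho : Odd (C.walk.rotate u hu').length := by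
    rw [C.walk.length_rotate]; exact C.odd_length
  match C.walk.rotate u hu', ho with
  | .nil, ho => simp at ho
  | .cons h p, ho =>
    obtain ⟨E, hE, hl, hs⟩ := exists_edges_of_even_walk p
      (by simpa [Nat.odd_add_one] using ho)
    exact ⟨E, hE, by simp [hl], by simpa using hs⟩

variable (G) in
/-- The pairs `(α, t)` such that `α` is a sum of exponent vectors of edges and of odd cycles
and `t` is the sum of the numbers of vertices of these edges and cycles. Thus `t / 2` is the size
of the half-integral matching that puts `1` on the edges and `1 / 2` on the edges of the cycles. -/
noncomputable def halfIntegralMatchings : AddSubmonoid ((V →₀ ℕ) × ℕ) :=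
  AddSubmonoid.closure
    ({x | ∃ e ∈ G.edgeSet, x = (edgeVec e, 2)} ∪ {x | ∃ C : OddCycle G, x = (C.vec, C.verts.card)})

theorem edgeVec_mem {e : Sym2 V} (he : e ∈ G.edgeSet) :
    (edgeVec e, 2) ∈ halfIntegralMatchings G :=
  AddSubmonoid.subset_closure (Or.inl ⟨e, he, rfl⟩)

theorem cycle_mem (C : OddCycle G) : (C.vec, C.verts.card) ∈ halfIntegralMatchings G :=
  AddSubmonoid.subset_closure (Or.inr ⟨C, rfl⟩)

theorem edges_mem (E : List (Sym2 V)) (hE : ∀ e ∈ E, e ∈ G.edgeSet) :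
    ((E.map edgeVec).sum, 2 * E.length) ∈ halfIntegralMatchings G := by
  induction E with
  | nil => exact zero_mem _
  | cons e E ih =>
    rw [List.forall_mem_cons] at hE
    convert! add_mem (edgeVec_mem hE.1) (ih hE.2) using 1
    simp [mul_add, add_comm]

theorem cycles_mem (L : List (OddCycle G)) :
    ((L.map OddCycle.vec).sum, (L.map fun C => C.verts.card).sum) ∈ halfIntegralMatchings G := by
  induction L with
  | nil => exact zero_mem _
  | cons C L ih => simpa using add_mem (cycle_mem C) ih

/-- A path closed up by an edge between its ends is an edge traversed twice, an even cycle or an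
odd cycle. In the first two cases every second edge is taken, in the last the cycle itself. -/
theorem closed_walk_mem_of_isPath {u v : V} (h : G.Adj u v) (p : G.Walk v u) (hp : p.IsPath) :
    (Finsupp.single v 1 + walkVec p, p.length + 1) ∈ halfIntegralMatchings G := by
  rcases Nat.even_or_odd p.length with he | ho
  · have hc : (SimpleGraph.Walk.cons h p).IsCycle := by
      rw [SimpleGraph.Walk.cons_isCycle_iff]
      refine ⟨hp, fun hm => ?_⟩
      rw [Sym2.eq_swap] at hm
      rw [hp.length_eq_one_of_mem_edges hm] at he
      exact Nat.not_even_one he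
    let C : OddCycle G := ⟨u, .cons h p, hc, by simpa using he.add_one⟩
    have := cycle_mem C
    rw [C.vec_eq_walkVec, C.card_verts] at this
    simpa [C] using this
  · obtain ⟨E, hE, hl, hs⟩ := exists_edges_of_even_walk (.cons h p) (by simpa using ho.add_one)
    have := edges_mem E hE
    rw [add_comm, add_left_inj] at hs
    rw [← hl, ← hs] at this
    simpa using this

/-- Loop erasure: cutting off the closed walks that are met on the way turns every walk into a
path with the same ends. -/
theorem exists_isPath_add {u v : V} (p : G.Walk u v) :
    ∃ q : G.Walk u v, q.IsPath ∧ ∃ x ∈ halfIntegralMatchings G,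
      (walkVec p, p.length) = (walkVec q, q.length) + x := by
  induction p with
  | nil => exact ⟨.nil, .nil, 0, zero_mem _, by simp⟩
  | cons h p ih =>
    rename_i a b c
    obtain ⟨q, hq, x, hx, hpq⟩ := ih
    rw [Prod.ext_iff] at hpq
    simp only [Prod.fst_add, Prod.snd_add] at hpq
    by_cases ha : a ∈ q.support
    · refine ⟨q.dropUntil a ha, hq.dropUntil ha, _,
        add_mem (closed_walk_mem_of_isPath h _ (hq.takeUntil ha)) hx, ?_⟩
      have hw := walkVec_append (q.takeUntil a ha) (q.dropUntil a ha)
      have hl := SimpleGraph.Walk.length_append (q.takeUntil a ha) (q.dropUntil a ha)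
      rw [q.take_spec] at hw hl
      ext1
      · simp only [walkVec_cons, Prod.fst_add, hpq.1, hw]; abel
      · simp only [SimpleGraph.Walk.length_cons, Prod.snd_add, hpq.2, hl]; omega
    · refine ⟨.cons h q, hq.cons ha, x, hx, ?_⟩
      ext1
      · simp only [walkVec_cons, Prod.fst_add, hpq.1]; abel
      · simp only [SimpleGraph.Walk.length_cons, Prod.snd_add, hpq.2]; omega

theorem closed_walk_mem {u : V} (p : G.Walk u u) :
    (walkVec p, p.length) ∈ halfIntegralMatchings G := by
  obtain ⟨q, hq, x, hx, h⟩ := exists_isPath_add p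
  obtain rfl : q = .nil := 
    SimpleGraph.Walk.eq_nil_iff_nil.mpr (SimpleGraph.Walk.isPath_iff_nil.mp hq)
  rw [h]
  exact add_mem (zero_mem _) hx

/-! ### Permutations along edges -/

/-- If a permutation moves points only along edges, each of its nontrivial cycles is a closed walk.
Hence the points that it moves carry a half-integral matching, of half their number as size. -/
theorem perm_mem {X : Type*} [Fintype X] [DecidableEq X] (π : X → V) (σ : Equiv.Perm X)
    (hσ : ∀ x, σ x ≠ x → G.Adj (π x) (π (σ x))) :
    (∑ x ∈ σ.support, Finsupp.single (π x) 1, σ.support.card) ∈ halfIntegralMatchings G := by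
  induction σ using Equiv.Perm.cycle_induction_on with
  | base_one =>
    rw [Equiv.Perm.support_one]
    exact zero_mem (halfIntegralMatchings G)
  | base_cycles σ hc =>
    obtain ⟨x, hx, -⟩ := id hc
    have hon : σ.IsCycleOn (σ.support : Set X) := by
      rw [Equiv.Perm.coe_support_eq_set_support]
      exact Equiv.Perm.IsCycle.isCycleOn hc
    obtain ⟨p, hl, hs⟩ := exists_walk_of_perm π σ hσ σ.support.card x x hx
      (hon.pow_card_apply (by simpa using hx))
    have himage : (Finset.range σ.support.card).image (fun i => (σ ^ i) (σ x)) = σ.support := by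
      ext y
      constructor
      · intro hy
        obtain ⟨i, -, rfl⟩ := Finset.mem_image.mp hy
        simpa using hx
      · intro hy
        obtain ⟨i, hi, rfl⟩ := hon.exists_pow_eq (a := σ x) (by simpa using hx) hy
        exact Finset.mem_image.mpr ⟨i, by simpa using hi, rfl⟩
    have hinj := Finset.card_image_iff.mp (by rw [himage, Finset.card_range] :
      ((Finset.range σ.support.card).image (fun i => (σ ^ i) (σ x))).card
        = (Finset.range σ.support.card).card)
    have hsum := Finset.sum_image (f := fun y => Finsupp.single (π y) 1) hinj
    rw [himage] at hsum
    have hmem := closed_walk_mem p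
    rwa [hl, hs, ← hsum] at hmem
  | induction_disjoint σ τ hd hc ihσ ihτ =>
    have h1 := ihσ fun x hx => by
      have := hσ x
      rwa [Equiv.Perm.mul_apply, (hd x).resolve_left hx, imp_iff_right hx] at this
    have h2 := ihτ fun x hx => by
      have := hσ x
      have h' : σ (τ x) = τ x := (hd (τ x)).resolve_right (by simpa using hx)
      rwa [Equiv.Perm.mul_apply, h', imp_iff_right hx] at this
    have := add_mem h1 h2
    rw [hd.support_mul, Finset.card_union_of_disjoint (hd.disjoint_support),
      Finset.sum_union hd.disjoint_support]
    exact this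

end Walks

/-! ### Eliminating adjacent odd cycles -/

section Cycles

variable {V : Type*} {G : SimpleGraph V}

theorem exists_adj_of_neighborhood_inter_ne_empty {A B : Set V}
    (h : neighborhood G A ∩ B ≠ ∅) : ∃ u ∈ A, ∃ v ∈ B, G.Adj u v := by
  obtain ⟨v, hv, hB⟩ := Set.nonempty_iff_ne_empty.mpr h
  obtain ⟨u, hu, huv⟩ := Set.mem_iUnion₂.mp hv
  exact ⟨u, hu, v, hB, huv⟩

theorem neighborhood_inter_eq_empty_symm {A B : Set V}
    (h : neighborhood G A ∩ B = ∅) : neighborhood G B ∩ A = ∅ := by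
  by_contra hne
  obtain ⟨u, hu, v, hv, huv⟩ := exists_adj_of_neighborhood_inter_ne_empty hne
  exact (Set.eq_empty_iff_forall_notMem.mp h) u
    ⟨Set.mem_iUnion₂.mpr ⟨v, hv, huv.symm⟩, hu⟩

variable [DecidableEq V]

/-- Two odd cycles joined by an edge `uv` can be traded for edges: `uv`, a perfect matching of the
first cycle without `u`, and a perfect matching of the second cycle without `v`. The cycles may
share vertices. -/
theorem exists_edges_of_adjacent_cycles {C D : OddCycle G}
    (h : neighborhood G (C.verts : Set V) ∩ (D.verts : Set V) ≠ ∅) :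
    ∃ E : List (Sym2 V), (∀ e ∈ E, e ∈ G.edgeSet) ∧
      C.verts.card + D.verts.card = 2 * E.length ∧ C.vec + D.vec = (E.map edgeVec).sum := by
  obtain ⟨u, hu, v, hv, huv⟩ := exists_adj_of_neighborhood_inter_ne_empty h
  obtain ⟨E, hE, hEl, hEs⟩ := C.exists_edges hu
  obtain ⟨F, hF, hFl, hFs⟩ := D.exists_edges hv
  refine ⟨s(u, v) :: (E ++ F), ?_, ?_, ?_⟩
  · simpa [or_imp, forall_and] using ⟨huv, hE, hF⟩
  · simp [hEl, hFl]; ring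
  · simp [hEs, hFs]; abel

theorem exists_pairwise_cycles (L : List (OddCycle G)) :
    ∃ (L' : List (OddCycle G)) (E : List (Sym2 V)),
      L'.Pairwise (fun C D => neighborhood G (C.verts : Set V) ∩ (D.verts : Set V) = ∅) ∧
      (∀ e ∈ E, e ∈ G.edgeSet) ∧
      (L.map OddCycle.vec).sum = (L'.map OddCycle.vec).sum + (E.map edgeVec).sum ∧
      (L.map fun C => C.verts.card).sum
        = (L'.map fun C => C.verts.card).sum + 2 * E.length := by
  induction L with
  | nil => exact ⟨[], [], by simp⟩
  | cons C L ih =>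
    obtain ⟨L', E, hp, hE, hs, hl⟩ := ih
    by_cases hC : ∀ D ∈ L', neighborhood G (C.verts : Set V) ∩ (D.verts : Set V) = ∅
    · exact ⟨C :: L', E, List.pairwise_cons.mpr ⟨hC, hp⟩, hE, by simp [hs, add_assoc],
        by simp [hl, add_assoc]⟩
    · push Not at hC
      obtain ⟨D, hD, hCD⟩ := hC
      obtain ⟨L₁, L₂, rfl⟩ := List.append_of_mem hD
      obtain ⟨F, hF, hFl, hFs⟩ := exists_edges_of_adjacent_cycles hCD.ne_empty
      refine ⟨L₁ ++ L₂, F ++ E, hp.sublist (by simp), ?_, ?_, ?_⟩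
      · simpa [or_imp, forall_and] using ⟨hF, hE⟩
      · simp only [List.map_append, List.map_cons, List.sum_append, List.sum_cons, hs, ← hFs]
        abel
      · simp only [List.map_append, List.map_cons, List.sum_append, List.sum_cons, hl,
          List.length_append, mul_add, ← hFl]
        ring

theorem exists_lists_of_mem {x : (V →₀ ℕ) × ℕ} (hx : x ∈ halfIntegralMatchings G) :
    ∃ (L : List (OddCycle G)) (E : List (Sym2 V)), (∀ e ∈ E, e ∈ G.edgeSet) ∧
      x.1 = (L.map OddCycle.vec).sum + (E.map edgeVec).sum ∧
      x.2 = (L.map fun C => C.verts.card).sum + 2 * E.length := by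
  induction hx using AddSubmonoid.closure_induction_left with
  | zero => exact ⟨[], [], by simp⟩
  | add_left x hx y _ ih =>
    obtain ⟨L, E, hE, hs, hl⟩ := ih
    rcases hx with ⟨e, he, rfl⟩ | ⟨C, rfl⟩
    · refine ⟨L, e :: E, by simpa using ⟨he, hE⟩, ?_, ?_⟩
      · simp [hs]; abel
      · simp [hl]; ring
    · exact ⟨C :: L, E, hE, by simp [hs, add_assoc], by simp [hl, add_assoc]⟩

/-- Every half-integral matching can be rewritten so that its odd cycles are pairwise disjoint and
without edges between them. -/
theorem exists_pairwise_lists_of_mem {x : (V →₀ ℕ) × ℕ} (hx : x ∈ halfIntegralMatchings G) :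
    ∃ (L : List (OddCycle G)) (E : List (Sym2 V)),
      L.Pairwise (fun C D => neighborhood G (C.verts : Set V) ∩ (D.verts : Set V) = ∅) ∧
      (∀ e ∈ E, e ∈ G.edgeSet) ∧
      x.1 = (L.map OddCycle.vec).sum + (E.map edgeVec).sum ∧
      x.2 = (L.map fun C => C.verts.card).sum + 2 * E.length := by
  obtain ⟨L, E, hE, hs, hl⟩ := exists_lists_of_mem hx
  obtain ⟨L', F, hp, hF, hs', hl'⟩ := exists_pairwise_cycles L
  refine ⟨L', F ++ E, hp, ?_, ?_, ?_⟩
  · simpa [or_imp, forall_and] using ⟨hF, hE⟩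
  · simp [hs, hs', add_assoc]
  · simp [hl, hl']; ring

end Cycles

/-! ### Monomials of powers of the edge ideal and of their integral closures -/

section Ideals

variable {V 𝕜 : Type*} [Field 𝕜] {G : SimpleGraph V}

theorem X_mul_X_mem_edgeIdeal {u v : V} (h : G.Adj u v) :
    (MvPolynomial.monomial (Finsupp.single u 1 + Finsupp.single v 1) 1 : MvPolynomial V 𝕜)
      ∈ edgeIdeal 𝕜 G :=
  Ideal.subset_span ⟨u, v, h, by simp [MvPolynomial.X, MvPolynomial.monomial_mul]⟩

theorem monomial_add_mem_pow {I : Ideal (MvPolynomial V 𝕜)} {α β : V →₀ ℕ} {m n : ℕ}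
    (hα : MvPolynomial.monomial α 1 ∈ I ^ m) (hβ : MvPolynomial.monomial β 1 ∈ I ^ n) :
    MvPolynomial.monomial (α + β) 1 ∈ I ^ (m + n) := by
  have := Ideal.mul_mem_mul hα hβ
  rwa [MvPolynomial.monomial_mul, one_mul, ← pow_add] at this

/-- The product of the edge monomials along a walk from `u` to `w` counts every visit to a vertex
twice, except for the two ends. -/
theorem exists_monomial_mem_of_walk {u w : V} (p : G.Walk u w) :
    ∃ γ : V →₀ ℕ, 2 • walkVec p + Finsupp.single u 1 = γ + Finsupp.single w 1 ∧
      (MvPolynomial.monomial γ 1 : MvPolynomial V 𝕜) ∈ edgeIdeal 𝕜 G ^ p.length := by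
  induction p with
  | nil => exact ⟨0, by simp, by simp⟩
  | cons h p ih =>
    rename_i a b c
    obtain ⟨γ, hγ, hm⟩ := ih
    refine ⟨γ + (Finsupp.single a 1 + Finsupp.single b 1), ?_, ?_⟩
    · calc 2 • walkVec (.cons h p) + Finsupp.single a 1
          = (2 • walkVec p + Finsupp.single b 1)
            + (Finsupp.single a 1 + Finsupp.single b 1) := by
            rw [walkVec_cons]; abel
        _ = _ := by rw [hγ]; abel
    · exact monomial_add_mem_pow hm (n := 1) (by simpa using X_mul_X_mem_edgeIdeal (𝕜 := 𝕜) h)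

theorem two_smul_mem_of_mem [DecidableEq V] {x : (V →₀ ℕ) × ℕ}
    (hx : x ∈ halfIntegralMatchings G) :
    (MvPolynomial.monomial (2 • x.1) 1 : MvPolynomial V 𝕜) ∈ edgeIdeal 𝕜 G ^ x.2 := by
  induction hx using AddSubmonoid.closure_induction with
  | mem x hx =>
    rcases hx with ⟨e, he, rfl⟩ | ⟨C, rfl⟩
    · induction e with
      | _ u v =>
        have h := X_mul_X_mem_edgeIdeal (𝕜 := 𝕜) (G := G) he
        have := monomial_add_mem_pow (m := 1) (n := 1) (by simpa using h) (by simpa using h)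
        rw [two_smul]
        exact this
    · obtain ⟨γ, hγ, hm⟩ := exists_monomial_mem_of_walk (𝕜 := 𝕜) C.walk
      rw [add_left_inj] at hγ
      rwa [← hγ, ← C.vec_eq_walkVec, ← C.card_verts] at hm
  | zero => simp
  | add x y _ _ hx hy =>
    have := monomial_add_mem_pow hx hy
    rwa [← smul_add] at this

/-- A half-integral matching of size at least `s` gives a monomial in the integral closure of
`I(G) ^ s`, since its square lies in `(I(G) ^ s) ^ 2`. -/
theorem monomial_mem_closure_of_mem [DecidableEq V] {β : V →₀ ℕ} {t s : ℕ}
    (h : (β, t) ∈ halfIntegralMatchings G) (hst : 2 * s ≤ t) :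
    (MvPolynomial.monomial β 1 : MvPolynomial V 𝕜)
      ∈ idealIntegralClosure (edgeIdeal 𝕜 G ^ s) := by
  rw [mem_idealIntegralClosure]
  have hmem : (MvPolynomial.monomial (2 • β) 1 : MvPolynomial V 𝕜) ∈ (edgeIdeal 𝕜 G ^ s) ^ 2 := by
    rw [← pow_mul, mul_comm]
    exact Ideal.pow_le_pow_right hst (two_smul_mem_of_mem h)
  refine ⟨2, fun i => if i = 2 then -MvPolynomial.monomial (2 • β) 1 else 0, two_pos, ?_, ?_⟩
  · intro i _
    dsimp only
    split_ifs with hi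
    · rw [hi]; exact neg_mem hmem
    · exact zero_mem _
  · simp [MvPolynomial.monomial_pow]

/-- If a monomial `x ^ α` is integral over a power of an ideal, comparing coefficients in the
equation of integral dependence produces an element of a further power in which a power of
`x ^ α` occurs. -/
theorem exists_coeff_ne_zero_of_integral {I : Ideal (MvPolynomial V 𝕜)} {s : ℕ} {α : V →₀ ℕ}
    (h : MvPolynomial.monomial α 1 ∈ idealIntegralClosure (I ^ s)) :
    ∃ k, 0 < k ∧ ∃ g ∈ I ^ (s * k), g.coeff (k • α) ≠ 0 := by
  classical
  obtain ⟨n, a, -, ha, heq⟩ := h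
  by_contra! hne
  have hzero : ∀ i ∈ Finset.Icc 1 n,
      (a i * MvPolynomial.monomial α 1 ^ (n - i)).coeff (n • α) = 0 := by
    intro i hi
    have hi' := Finset.mem_Icc.mp hi
    rw [MvPolynomial.monomial_pow, one_pow]
    have : n • α = i • α + (n - i) • α := by rw [← add_smul, Nat.add_sub_cancel' hi'.2]
    rw [this, MvPolynomial.coeff_mul_monomial, mul_one]
    exact hne i hi'.1 _ (by rw [pow_mul]; exact ha i hi)
  have := congrArg (MvPolynomial.coeff (n • α)) heq
  rw [MvPolynomial.coeff_add, MvPolynomial.coeff_sum, Finset.sum_eq_zero hzero,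
    MvPolynomial.monomial_pow, one_pow, MvPolynomial.coeff_monomial, if_pos rfl, add_zero,
    MvPolynomial.coeff_zero] at this
  exact one_ne_zero this

/-- A monomial occurring in an element of `I(G) ^ n` is divisible by a product of `n` edges. The
multiset of edges is recorded by its symmetric matrix of multiplicities. -/
theorem exists_matrix_of_coeff_ne_zero [Fintype V] (n : ℕ) {g : MvPolynomial V 𝕜}
    (hg : g ∈ edgeIdeal 𝕜 G ^ n) {m : V →₀ ℕ} (hm : g.coeff m ≠ 0) :
    ∃ M : V → V → ℕ, (∀ u v, M u v = M v u) ∧ (∀ u v, M u v ≠ 0 → G.Adj u v) ∧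
      (∀ u, ∑ v, M u v ≤ m u) ∧ ∑ u, ∑ v, M u v = 2 * n := by
  classical
  induction n generalizing g m with
  | zero => exact ⟨0, by simp⟩
  | succ n ih =>
    rw [pow_succ] at hg
    induction hg using Submodule.mul_induction_on' generalizing m with
    | add x _ y _ hx hy =>
      rw [MvPolynomial.coeff_add] at hm
      by_cases h : x.coeff m = 0
      · exact hy (by simpa [h] using hm)
      · exact hx h
    | mem_mul_mem x hx y hy =>
      rw [MvPolynomial.coeff_mul] at hm
      obtain ⟨⟨m₁, m₂⟩, hsum, hne⟩ := Finset.exists_ne_zero_of_sum_ne_zero hm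
      rw [Finset.HasAntidiagonal.mem_antidiagonal] at hsum
      obtain ⟨M, hsymm, hadj, hle, htot⟩ := ih hx (left_ne_zero_of_mul hne)
      have hset : {f : MvPolynomial V 𝕜 | ∃ u v : V, G.Adj u v ∧
          f = MvPolynomial.X u * MvPolynomial.X v} = (fun s => MvPolynomial.monomial s 1) ''
          {s | ∃ u v, G.Adj u v ∧ s = Finsupp.single u 1 + Finsupp.single v 1} := by
        ext f
        constructor
        · rintro ⟨u, v, h, rfl⟩
          exact ⟨_, ⟨u, v, h, rfl⟩, by simp [MvPolynomial.X, MvPolynomial.monomial_mul]⟩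
        · rintro ⟨_, ⟨u, v, h, rfl⟩, rfl⟩
          exact ⟨u, v, h, by simp [MvPolynomial.X, MvPolynomial.monomial_mul]⟩
      rw [edgeIdeal, hset, MvPolynomial.mem_ideal_span_monomial_image] at hy
      obtain ⟨_, ⟨a, b, hab, rfl⟩, hle'⟩ := hy m₂
        (MvPolynomial.mem_support_iff.mpr (right_ne_zero_of_mul hne))
      -- The multiplicity matrix of the single edge `ab`; as `G` has no loops, `a ≠ b`.
      let N : V → V → ℕ := fun u v =>
        (Finsupp.single a 1 u * Finsupp.single b 1 v : ℕ)
          + Finsupp.single b 1 u * Finsupp.single a 1 v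
      have hrow : ∀ u, ∑ v, N u v = (Finsupp.single a 1 + Finsupp.single b 1 : V →₀ ℕ) u := by
        intro u
        simp [N, Finset.sum_add_distrib, Finsupp.single_apply]
      refine ⟨fun u v => M u v + N u v, ?_, ?_, ?_, ?_⟩
      · intro u v
        simp only [hsymm u v, N]
        ring
      · intro u v huv
        by_cases h : M u v = 0
        · simp only [N, h, zero_add] at huv
          simp only [Finsupp.single_apply] at huv
          by_cases h1 : a = u ∧ b = v
          · rw [← h1.1, ← h1.2]; exact hab
          · by_cases h2 : b = u ∧ a = v
            · rw [← h2.1, ← h2.2]; exact hab.symm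
            · exfalso
              grind
        · exact hadj u v h
      · intro u
        rw [Finset.sum_add_distrib, hrow, ← hsum]
        exact add_le_add (hle u) (hle' u)
      · simp only [Finset.sum_add_distrib, htot, hrow]
        simp [Finset.sum_add_distrib, Finsupp.single_apply]
        ring

end Ideals

/-! ### Half-integrality of fractional matchings -/

section Birkhoff

/-- Birkhoff's theorem for the off-diagonal part of a doubly stochastic matrix: some permutation
moves points only to nonzero entries of the matrix, and moves at least as many points as the sum
of the off-diagonal entries. -/
theorem exists_perm_of_mem_doublyStochastic {X : Type*} [Fintype X] [DecidableEq X]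
    {D : Matrix X X ℚ} (hD : D ∈ doublyStochastic ℚ X) :
    ∃ σ : Equiv.Perm X, (∀ x, D x (σ x) ≠ 0) ∧
      ∑ x, ∑ y, (if x = y then 0 else D x y) ≤ σ.support.card := by
  obtain ⟨w, hw, hw1, rfl⟩ := exists_eq_sum_perm_of_mem_doublyStochastic hD
  have hentry : ∀ x y, (∑ σ : Equiv.Perm X, w σ • σ.permMatrix ℚ) x y
      = ∑ σ, if σ x = y then w σ else 0 := by
    intro x y
    simp [Matrix.sum_apply, Equiv.Perm.permMatrix, PEquiv.toMatrix_apply, eq_comm]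
  have htotal : ∑ x, ∑ y, (if x = y then 0 else (∑ σ : Equiv.Perm X, w σ • σ.permMatrix ℚ) x y)
      = ∑ σ, w σ * σ.support.card := by
    have : ∀ x, ∑ y, (if x = y then 0 else (∑ σ : Equiv.Perm X, w σ • σ.permMatrix ℚ) x y)
        = ∑ σ : Equiv.Perm X, if σ x ≠ x then w σ else 0 := by
      intro x
      have h : ∀ y, (if x = y then 0 else (∑ σ : Equiv.Perm X, w σ • σ.permMatrix ℚ) x y)
          = ∑ σ : Equiv.Perm X, if σ x = y then (if x = y then 0 else w σ) else 0 := by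
        intro y
        rw [hentry]
        split_ifs <;> simp
      simp only [h]
      rw [Finset.sum_comm]
      refine Finset.sum_congr rfl fun σ _ => ?_
      rw [Finset.sum_ite_eq]
      simp [eq_comm]
    simp only [this]
    rw [Finset.sum_comm]
    refine Finset.sum_congr rfl fun σ _ => ?_
    rw [← Finset.sum_filter, Finset.sum_const, nsmul_eq_mul, mul_comm]
    rfl
  rw [htotal]
  set T := ∑ σ, w σ * (σ.support.card : ℚ) with hT
  -- A weighted average is at most the value at some permutation of positive weight.
  obtain ⟨σ, hσ, hle⟩ : ∃ σ, 0 < w σ ∧ T ≤ σ.support.card := by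
    by_contra! hlt
    have hle : ∀ σ ∈ Finset.univ, w σ * (σ.support.card : ℚ) ≤ w σ * T := fun σ _ => by
      rcases (hw σ).eq_or_lt with h | h
      · simp [← h]
      · exact mul_le_mul_of_nonneg_left (hlt σ h).le (hw σ)
    obtain ⟨σ, -, hσ⟩ := Finset.exists_ne_zero_of_sum_ne_zero (hw1.trans_ne one_ne_zero)
    have hσ' : 0 < w σ := (hw σ).lt_of_ne' hσ
    have := Finset.sum_lt_sum hle
      ⟨σ, Finset.mem_univ _, mul_lt_mul_of_pos_left (hlt σ hσ') hσ'⟩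
    rw [← Finset.sum_mul, hw1, one_mul] at this
    exact this.ne hT.symm
  refine ⟨σ, fun x => ?_, hle⟩
  rw [hentry]
  refine (hσ.trans_le ?_).ne'
  have := Finset.single_le_sum (f := fun τ : Equiv.Perm X => if τ x = σ x then w τ else 0)
    (fun τ _ => by
      split_ifs
      exacts [hw τ, le_rfl]) (Finset.mem_univ σ)
  simpa using this

/-- Spreading a function on `V` evenly over `α v` copies of each `v` keeps its sum, provided that
the function vanishes where there are no copies. -/
theorem sum_sigma_div {V : Type*} [Fintype V] (α : V → ℕ) (g : V → ℚ)
    (hg : ∀ v, α v = 0 → g v = 0) : ∑ y : Σ v, Fin (α v), g y.1 / α y.1 = ∑ v, g v := by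
  rw [Fintype.sum_sigma]
  refine Finset.sum_congr rfl fun v _ => ?_
  dsimp only
  rw [Finset.sum_const, Finset.card_univ, Fintype.card_fin, nsmul_eq_mul]
  by_cases h : α v = 0
  · simp [h, hg v h]
  · field_simp

variable {V : Type*} [Fintype V] [DecidableEq V] {G : SimpleGraph V}

/-- A fractional matching with vertex capacities `α` may be replaced by a half-integral one of at
least the same size. The fractional matching is `M / k`. Replacing every vertex `v` by `α v`
copies and filling up the diagonal turns it into a doubly stochastic matrix. -/
theorem exists_mem_of_matrix {α : V →₀ ℕ} {s k : ℕ} (hk : 0 < k) (M : V → V → ℕ)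
    (hsymm : ∀ u v, M u v = M v u) (hadj : ∀ u v, M u v ≠ 0 → G.Adj u v)
    (hle : ∀ u, ∑ v, M u v ≤ k * α u) (htot : ∑ u, ∑ v, M u v = 2 * (s * k)) :
    ∃ β t, (β, t) ∈ halfIntegralMatchings G ∧ β ≤ α ∧ 2 * s ≤ t := by
  have hk' : (0 : ℚ) < k := by exact_mod_cast hk
  have hM0 : ∀ u v, α u = 0 → M u v = 0 := by
    intro u v hu
    have := hle u
    rw [hu, mul_zero, Nat.le_zero, Finset.sum_eq_zero_iff] at this
    exact this v (Finset.mem_univ v)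
  let X := Σ v, Fin (α v)
  let W : X → X → ℚ := fun x y => (M x.1 y.1 / (k * α x.1) : ℚ) / α y.1
  have hα : ∀ x : X, (0 : ℚ) < α x.1 := fun x => by
    exact_mod_cast (Nat.zero_le _).trans_lt x.2.isLt
  have hW0 : ∀ x y, 0 ≤ W x y := fun x y => by positivity
  have hWsymm : ∀ x y, W x y = W y x := fun x y => by
    simp only [W, hsymm x.1 y.1]
    rw [div_div, div_div]
    congr 1
    ring
  have hWdiag : ∀ x, W x x = 0 := fun x => by
    have : M x.1 x.1 = 0 := by
      by_contra h
      exact G.irrefl (hadj _ _ h)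
    simp [W, this]
  have hrow : ∀ x, ∑ y, W x y = (∑ v, (M x.1 v : ℚ)) / (k * α x.1) := fun x => by
    rw [Finset.sum_div]
    exact sum_sigma_div α (fun v => (M x.1 v / (k * α x.1) : ℚ))
      fun v hv => by simp [hsymm x.1 v, hM0 v x.1 hv]
  have hrow1 : ∀ x, ∑ y, W x y ≤ 1 := fun x => by
    rw [hrow, div_le_one (mul_pos hk' (hα x))]
    exact_mod_cast hle x.1
  have hWtot : ∑ x, ∑ y, W x y = 2 * s := by
    have h1 : ∀ x, ∑ y, W x y = (∑ v, (M x.1 v : ℚ)) / k / α x.1 := fun x => by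
      rw [hrow, div_div]
    simp only [h1]
    refine (sum_sigma_div α (fun u => (∑ v, (M u v : ℚ)) / k)
      fun u hu => by simp [hM0 u _ hu]).trans ?_
    rw [← Finset.sum_div, div_eq_iff hk'.ne', mul_assoc]
    exact_mod_cast htot
  -- The symmetry of `W` lets the same diagonal entry complete both the row and the column.
  let D : Matrix X X ℚ := fun x y => W x y + if x = y then 1 - ∑ z, W x z else 0
  have hD : D ∈ doublyStochastic ℚ X := by
    rw [mem_doublyStochastic_iff_sum]
    refine ⟨fun x y => ?_, fun x => ?_, fun y => ?_⟩
    · refine add_nonneg (hW0 x y) ?_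
      split_ifs
      · linarith [hrow1 x]
      · exact le_rfl
    · simp [D, Finset.sum_add_distrib]
    · simp [D, Finset.sum_add_distrib, hWsymm _ y]
  obtain ⟨σ, hσ, hcard⟩ := exists_perm_of_mem_doublyStochastic hD
  have hoff : ∀ x y, (if x = y then 0 else D x y) = W x y := by
    intro x y
    split_ifs with h
    · rw [h, hWdiag]
    · simp [D, h]
  simp only [hoff, hWtot] at hcard
  refine ⟨_, _, perm_mem Sigma.fst σ fun x hx => hadj _ _ fun h => hσ x ?_, ?_, ?_⟩
  · simp [D, Ne.symm hx, W, h]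
  · have hall : ∑ x : X, Finsupp.single x.1 1 = α := by
      rw [Fintype.sum_sigma]
      simp
    exact (Finset.sum_le_sum_of_subset (Finset.subset_univ _)).trans_eq hall
  · exact_mod_cast hcard

end Birkhoff

/-! ### Minimal generators -/

section Generators

variable {V 𝕜 : Type*} [Field 𝕜] {G : SimpleGraph V}

theorem monomial_list_sum (L : List (V →₀ ℕ)) :
    (MvPolynomial.monomial L.sum 1 : MvPolynomial V 𝕜)
      = (L.map fun α => MvPolynomial.monomial α 1).prod := by
  induction L with
  | nil => simp
  | cons α L ih => rw [List.sum_cons, List.map_cons, List.prod_cons, ← ih]; simp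

theorem monomial_edgeVec (e : Sym2 V) :
    (MvPolynomial.monomial (edgeVec e) 1 : MvPolynomial V 𝕜) = edgeMonomial 𝕜 e := by
  induction e with
  | _ u v => simp [edgeMonomial, MvPolynomial.X, MvPolynomial.monomial_mul]

theorem OddCycle.monomial_vec [DecidableEq V] (C : OddCycle G) :
    (MvPolynomial.monomial C.vec 1 : MvPolynomial V 𝕜) = C.monomial 𝕜 := by
  rw [OddCycle.vec, OddCycle.monomial, MvPolynomial.monomial_sum_one]
  rfl

theorem even_sum_map_card_verts_iff [DecidableEq V] (L : List (OddCycle G)) :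
    Even (L.map fun C => C.verts.card).sum ↔ Even L.length := by
  induction L with
  | nil => simp
  | cons C L ih =>
    rw [List.map_cons, List.sum_cons, Nat.even_add, ih, List.length_cons, Nat.even_add_one]
    simp [Nat.not_even_iff_odd.mpr C.odd_card_verts]

/-- If no half-integral matching of size at least `s` fits strictly below `β`, then a
half-integral matching on `β` of size at least `s` has size exactly `s`: otherwise an edge could be
dropped, or an odd cycle replaced by a perfect matching of the cycle without one vertex. -/
theorem size_eq_of_minimal [DecidableEq V] {s : ℕ} {L : List (OddCycle G)} {E : List (Sym2 V)}
    (hE : ∀ e ∈ E, e ∈ G.edgeSet)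
    (hs : 2 * s ≤ (L.map fun C => C.verts.card).sum + 2 * E.length)
    (hmin : ∀ β t, (β, t) ∈ halfIntegralMatchings G → 2 * s ≤ t →
      β ≤ (L.map OddCycle.vec).sum + (E.map edgeVec).sum →
      β = (L.map OddCycle.vec).sum + (E.map edgeVec).sum) :
    (L.map fun C => C.verts.card).sum + 2 * E.length = 2 * s := by
  by_contra hne
  match L, E with
  | C :: L, E =>
    obtain ⟨u, hu⟩ : C.verts.Nonempty := Finset.card_pos.mp C.odd_card_verts.pos
    obtain ⟨F, hF, hFl, hFs⟩ := C.exists_edges hu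
    have hmem := add_mem (add_mem (edges_mem F hF) (cycles_mem L)) (edges_mem E hE)
    simp only [List.map_cons, List.sum_cons] at hs hne hmin
    have hβ : C.vec + (L.map OddCycle.vec).sum + (E.map edgeVec).sum =
        (F.map edgeVec).sum + (L.map OddCycle.vec).sum + (E.map edgeVec).sum
          + Finsupp.single u 1 := by
      rw [hFs]; abel
    have := hmin _ _ hmem (by simp only [Prod.snd_add]; omega) (by rw [hβ]; exact le_self_add)
    simp [hβ] at this
  | [], e :: E =>
    rw [List.forall_mem_cons] at hE
    simp only [List.map_nil, List.sum_nil, zero_add, List.map_cons, List.sum_cons,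
      List.length_cons] at hs hne hmin
    have := hmin _ _ (edges_mem E hE.2) (by omega) le_add_self
    exact edgeVec_ne_zero e (by simpa using this.symm)
  | [], [] => simp at hs hne; omega

end Generators

end EdgeIdeal

theorem mainTheorem5 {𝕜 : Type*} [Field 𝕜] {V : Type*} [Fintype V] [DecidableEq V]
    (G : SimpleGraph V) (s : ℕ) (f : MvPolynomial V 𝕜)
    (hf : EdgeIdeal.IsMinimalGenerator (EdgeIdeal.idealIntegralClosure (EdgeIdeal.edgeIdeal 𝕜 G ^ s)) f) :
    ∃ (a b : ℕ) (C : Fin (2 * a) → EdgeIdeal.OddCycle G) (e : Fin b → Sym2 V),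
      (∀ j, e j ∈ G.edgeSet) ∧
      f = (∏ i, (C i).monomial 𝕜) * ∏ j, EdgeIdeal.edgeMonomial 𝕜 (e j) ∧
      (∑ i, ((C i).verts.card : ℚ)) / 2 + (b : ℚ) = (s : ℚ) ∧
      ∀ i j, i ≠ j →
        EdgeIdeal.neighborhood G ((C i).verts : Set V) ∩ ((C j).verts : Set V) = ∅ := by
  open EdgeIdeal in
  obtain ⟨α, rfl, hmem, hmin⟩ := hf
  obtain ⟨k, hk, g, hg, hcoeff⟩ := exists_coeff_ne_zero_of_integral hmem
  obtain ⟨M, hsymm, hadj, hle, htot⟩ := exists_matrix_of_coeff_ne_zero _ hg hcoeff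
  obtain ⟨β, t, hβ, hβα, hst⟩ := exists_mem_of_matrix hk M hsymm hadj (by simpa using hle) htot
  obtain rfl : β = α := hmin β hβα (monomial_mem_closure_of_mem hβ hst)
  obtain ⟨L, E, hL, hE, hsum, hsize⟩ := exists_pairwise_lists_of_mem hβ
  dsimp only at hsum hsize
  subst hsum hsize
  have hs := size_eq_of_minimal hE hst fun γ r hγ hr hγle =>
    hmin γ hγle (monomial_mem_closure_of_mem hγ hr)
  obtain ⟨a, ha⟩ : Even L.length := by
    rw [← even_sum_map_card_verts_iff]
    have : Even ((L.map fun C => C.verts.card).sum + 2 * E.length) := hs ▸ even_two_mul s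
    exact (Nat.even_add.mp this).mpr (even_two_mul _)
  rw [← two_mul] at ha
  refine ⟨a, E.length, fun i => L.get (i.cast ha.symm), E.get, fun j => hE _ (E.get_mem j),
    ?_, ?_, fun i j hij => ?_⟩
  · have h1 : ∏ i : Fin (2 * a), (L.get (i.cast ha.symm)).monomial 𝕜
        = (L.map fun C => C.monomial 𝕜).prod := by
      rw [← Fin.prod_univ_fun_getElem]
      exact Fintype.prod_equiv (finCongr ha.symm) _ _ fun _ => rfl
    have h2 : ∏ j, edgeMonomial 𝕜 (E.get j) = (E.map (edgeMonomial 𝕜)).prod :=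
      Fin.prod_univ_fun_getElem E _
    rw [h1, h2, ← one_mul (1 : 𝕜), ← MvPolynomial.monomial_mul, monomial_list_sum,
      monomial_list_sum, List.map_map, List.map_map]
    congr 2
    · exact List.map_congr_left fun C _ => C.monomial_vec
    · exact List.map_congr_left fun e _ => monomial_edgeVec e
  · have h1 : ∑ i : Fin (2 * a), (L.get (i.cast ha.symm)).verts.card
        = (L.map fun C => C.verts.card).sum := by
      rw [← Fin.sum_univ_fun_getElem]
      exact Fintype.sum_equiv (finCongr ha.symm) _ _ fun _ => rfl
    rw [← h1] at hs
    have hs' := congrArg (Nat.cast : ℕ → ℚ) hs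
    push_cast at hs'
    linarith
  · have hget := List.pairwise_iff_get.mp hL
    rcases lt_or_gt_of_ne hij with h | h
    · exact hget (i.cast ha.symm) (j.cast ha.symm) h
    · exact neighborhood_inter_eq_empty_symm (hget (j.cast ha.symm) (i.cast ha.symm) h)
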